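/- An automaton with $n$ states is a set $\Sigma\subset\{0,1\}^{n\times n}$ of row-stochastic matrices (the letters); a word of length $t$ is a product of $t$ letters, the word of length $0$ being the identity matrix. The automaton is synchronizing if some word has all its rows equal to one and the same standard basis vector, and strongly connected if every state can be reached from every state in the directed graph with an edge from $i$ to $j$ whenever $L_{ij}=1$ for some letter $L\in\Sigma$. The triple rendezvous time $T_3$ of $\Sigma$ is the smallest integer $t\ge 0$ such that some word of length at most $t$ has a column with at least three non-zero entries, i.e. such that some word of length at most $t$ maps three distinct states to one state. Proposition. Let $n\ge 3$ and let $\Sigma$ be a strongly connected synchronizing automaton with $n$ states. Then $T_3$ exists, and for every integer $s$ with $1\le s\le n/2$, $$T_3\le \max\left\{\frac{n(s+2)}{2},\ \frac{n(n+4)-(2s-1)(2s+3)+1}{4}\right\}.$$ -/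

import Mathlib

open scoped BigOperators

noncomputable section

/-- A (deterministic, finite state, complete) automaton with `n` states: a set of
row-stochastic matrices with entries in `{0, 1}`, one for each letter
(such a set is automatically finite). -/
def IsAutomaton {n : ℕ} (S : Set (Matrix (Fin n) (Fin n) ℝ)) : Prop :=
  ∀ L ∈ S, (∀ i j, L i j = 0 ∨ L i j = 1) ∧ ∀ i, ∑ j, L i j = 1

/-- The words of length `t`: the products of `t` letters (the identity matrix for `t = 0`). -/
def wordsOfLength {n : ℕ} (S : Set (Matrix (Fin n) (Fin n) ℝ)) (t : ℕ) :
    Set (Matrix (Fin n) (Fin n) ℝ) :=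
  {W | ∃ l : List (Matrix (Fin n) (Fin n) ℝ), l.length = t ∧ (∀ L ∈ l, L ∈ S) ∧ l.prod = W}

/-- The words of length at most `t`. -/
def wordsUpTo {n : ℕ} (S : Set (Matrix (Fin n) (Fin n) ℝ)) (t : ℕ) :
    Set (Matrix (Fin n) (Fin n) ℝ) :=
  {W | ∃ r, r ≤ t ∧ W ∈ wordsOfLength S r}

/-- Some word maps all states to a single state `i`, i.e. has all its rows equal to the
`i`-th standard basis vector. -/
def IsSynchronizing {n : ℕ} (S : Set (Matrix (Fin n) (Fin n) ℝ)) : Prop :=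
  ∃ (t : ℕ) (W : Matrix (Fin n) (Fin n) ℝ) (i : Fin n),
    W ∈ wordsOfLength S t ∧ W = Matrix.of (fun _ => (Pi.single i 1 : Fin n → ℝ))

/-- Every state can be reached from every state along transitions of the automaton. -/
def IsStronglyConnected {n : ℕ} (S : Set (Matrix (Fin n) (Fin n) ℝ)) : Prop :=
  ∀ i j : Fin n, Relation.ReflTransGen (fun a b => ∃ L ∈ S, L a b = 1) i j

/-- The set `A(t)` of vectors reachable at `t`: the columns of the words of length at most `t`. -/
def reachableVectors {n : ℕ} (S : Set (Matrix (Fin n) (Fin n) ℝ)) (t : ℕ) :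
    Set (Fin n → ℝ) :=
  {v | ∃ W ∈ wordsUpTo S t, ∃ j : Fin n, v = fun i => W i j}

/-- The times `t` at which `A(t)` contains a column of weight at least three; the weight of a
vector is its number of non-zero entries. -/
def tripleTimes {n : ℕ} (S : Set (Matrix (Fin n) (Fin n) ℝ)) : Set ℕ :=
  {t | ∃ v ∈ reachableVectors S t, 3 ≤ hammingNorm v}

/-- The triple rendezvous time `T₃`: the smallest `t` such that `A(t)` contains a column of
weight at least three (meaningful when there is such a `t`). -/
def tripleRendezvousTime {n : ℕ} (S : Set (Matrix (Fin n) (Fin n) ℝ)) : ℕ :=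
  sInf (tripleTimes S)

end

/-!
Join two states by an edge of the graph `G t` when some word of length at most `t` merges them, and
suppose that no word of length at most `b` merges three states. Then `G t` gains an edge at every
step up to `b`, so the theorem follows from upper bounds on the degrees.

A letter moves the fractional stable sets of `G (t + 1)` into those of `G t`. If the fractional
vertex cover number of the two graphs is the same, optimal fractional stable sets go to optimal
ones, and the linear span of the optimal ones must be smaller for `G (t + 1)` than for `G t`: a span
invariant under all letters is everything, by synchronization and strong connectivity, whereas its
dimension is at most the fractional vertex cover number plus one. Hence a large cover number at time
`t` leaves few steps until `b`.

If a word `w` of length `j` maps two states to `v`, the image of `w` misses all neighbours of `v` in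
`G (b - j)`, as merging a third state would create a triple. A word with a small image forces a
large cover number at time `j`, so `v` has small degree in `G (b - j)` when `b` is large. Adding up
these degrees over all `v`, with the shortest possible `j` for each, leaves too few edges.
-/

namespace TripleRendezvous

open Finset

section LinearAlgebra

variable {K E ι : Type*} [Field K] {M : Finset ι} {g : ι → ι}

theorem two_mul_finrank_span_range_le [AddCommGroup E] [Module K E] (hg : Set.InjOn g M)
    (hfix : ∀ i ∈ M, g i ≠ i) (c : ι → E) (hneg : ∀ i ∈ M, c (g i) = -c i)
    (hzero : ∀ i ∉ M, c i = 0) :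
    2 * Module.finrank K (Submodule.span K (Set.range c)) ≤ #M := by
  obtain ⟨κ, a, ha, hspan, hli⟩ := exists_linearIndependent' K c
  have mem_of_ne_zero {i : ι} (hi : c i ≠ 0) : i ∈ M := not_imp_comm.1 (hzero i) hi
  have ha_mem (k : κ) : a k ∈ M := mem_of_ne_zero (hli.ne_zero k)
  have : Finite κ := .of_injective (fun k ↦ (⟨a k, ha_mem k⟩ : M)) fun _ _ hkl ↦
    ha (congrArg Subtype.val hkl)
  cases nonempty_fintype κ
  have hga_mem (k : κ) : g (a k) ∈ M :=
    mem_of_ne_zero (by rw [hneg _ (ha_mem k)]; exact neg_ne_zero.2 (hli.ne_zero k))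
  have a_ne_ga (k l : κ) : a k ≠ g (a l) := fun hkl ↦ by
    have hc : (1 : K) • c (a k) = (-1 : K) • c (a l) := by
      rw [hkl, hneg _ (ha_mem l), one_smul, neg_one_smul]
    obtain rfl := hli.eq_of_smul_apply_eq_smul_apply 1 (-1) k l one_ne_zero hc
    exact hfix _ (ha_mem k) hkl.symm
  have hinj : Function.Injective (Sum.elim a (g ∘ a)) :=
    ha.sumElim (fun k l hkl ↦ ha (hg (ha_mem k) (ha_mem l) hkl)) a_ne_ga
  rw [← hspan, finrank_span_eq_card hli, two_mul, ← Fintype.card_sum, ← card_univ]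
  exact card_le_card_of_injOn _ (by rintro (k | k) - <;> simp [ha_mem, hga_mem]) hinj.injOn

/-- The functions supported on `M` that change sign along the map `g`. -/
def alternating (K : Type*) [Field K] (M : Finset ι) (g : ι → ι) : Submodule K (ι → K) where
  carrier := {x | (∀ i ∈ M, x (g i) = -x i) ∧ ∀ i ∉ M, x i = 0}
  zero_mem' := by simp
  add_mem' hx hy :=
    ⟨fun i hi ↦ by simp only [Pi.add_apply, hx.1 i hi, hy.1 i hi, neg_add],
      fun i hi ↦ by simp only [Pi.add_apply, hx.2 i hi, hy.2 i hi, add_zero]⟩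
  smul_mem' a x hx :=
    ⟨fun i hi ↦ by simp only [Pi.smul_apply, hx.1 i hi, smul_neg],
      fun i hi ↦ by simp only [Pi.smul_apply, hx.2 i hi, smul_zero]⟩

/-- Row rank equals column rank for the matrix whose rows are a basis of the space: its columns
change sign along `g`. -/
theorem two_mul_finrank_alternating_le [Finite ι] (hg : Set.InjOn g M) (hfix : ∀ i ∈ M, g i ≠ i) :
    2 * Module.finrank K (alternating K M g) ≤ #M := by
  cases nonempty_fintype ι
  let b := Module.finBasis K (alternating K M g)
  let A : Matrix (Fin (Module.finrank K (alternating K M g))) ι K := .of fun l ↦ (b l : ι → K)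
  have hrow : LinearIndependent K A.row :=
    b.linearIndependent.map' (alternating K M g).subtype (Submodule.ker_subtype _)
  have hrank : A.rank = Module.finrank K (alternating K M g) := by
    rw [hrow.rank_matrix, Fintype.card_fin]
  rw [← hrank, A.rank_eq_finrank_span_cols]
  exact two_mul_finrank_span_range_le hg hfix A.col
    (fun i hi ↦ funext fun l ↦ (b l).2.1 i hi) fun i hi ↦ funext fun l ↦ (b l).2.2 i hi

end LinearAlgebra

section FractionalStableSets

theorem exists_injOn_of_card_le_card_biUnion_add {ι α : Type*} [Fintype ι] [DecidableEq α]
    [Nonempty α] (T : ι → Finset α) (d : ℕ) (h : ∀ S : Finset ι, #S ≤ #(S.biUnion T) + d) :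
    ∃ (M : Finset ι) (g : ι → α),
      Set.InjOn g M ∧ (∀ i ∈ M, g i ∈ T i) ∧ Fintype.card ι ≤ #M + d := by
  classical
  -- Hall's theorem after adding `d` new elements to every set.
  obtain ⟨f, hf, hfT⟩ := (all_card_le_biUnion_card_iff_exists_injective
    fun i ↦ (T i).disjSum (univ : Finset (Fin d))).1 fun S ↦ by
      rcases S.eq_empty_or_nonempty with rfl | ⟨i₀, hi₀⟩
      · simp
      calc #S ≤ #(S.biUnion T) + d := h S
        _ = #((S.biUnion T).disjSum (univ : Finset (Fin d))) := by simp
        _ ≤ _ := card_le_card fun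
          | .inl a => by simp
          | .inr k => fun _ ↦ mem_biUnion.2 ⟨i₀, hi₀, by simp⟩
  let M : Finset ι := {i | (f i).isLeft}
  have hMg : ∀ i, ∃ a, i ∈ M → f i = .inl a := fun i ↦ by
    rcases hi : f i with a | k
    · exact ⟨a, fun _ ↦ rfl⟩
    · exact ⟨Classical.arbitrary α, by simp [M, hi]⟩
  choose g hg using hMg
  refine ⟨M, g, fun i hi j hj hij ↦ hf ?_, fun i hi ↦ ?_, ?_⟩
  · rw [hg i hi, hg j hj, hij]
  · simpa [hg i hi] using hfT i
  · have hMc : #Mᶜ ≤ #(univ.map .inr : Finset (α ⊕ Fin d)) :=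
      card_le_card_of_injOn f (fun i hi ↦ by cases hfi : f i <;> simp_all [M]) hf.injOn
    rw [← card_add_card_compl M]
    simpa only [add_le_add_iff_left, card_map, card_univ, Fintype.card_fin] using hMc

variable {V : Type*} {G H : SimpleGraph V} {x : V → ℝ}

/-- The fractional stable sets of `G`: the weights in `[0, 1]` whose sum along every edge is at
most `1`. -/
def fracStable (G : SimpleGraph V) : Set (V → ℝ) :=
  {x | (∀ i, x i ∈ Set.Icc 0 1) ∧ ∀ ⦃i j⦄, G.Adj i j → x i + x j ≤ 1}

theorem fracStable_anti (hGH : G ≤ H) : fracStable H ⊆ fracStable G :=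
  fun _ hx ↦ ⟨hx.1, fun _ _ hij ↦ hx.2 (hGH hij)⟩

variable [Fintype V] [DecidableEq V] [DecidableRel G.Adj] [DecidableRel H.Adj] {M : Finset V}
  {g : V → V}

/-- The minimum size of a vertex cover of the bipartite double cover of `G`. It is attained by a
cover consisting of the complement of a set `S` on one side and the neighbours of `S` on the other,
and `doubleCoverNumber G / 2` is the fractional vertex cover number of `G`. -/
noncomputable def doubleCoverNumber (G : SimpleGraph V) [DecidableRel G.Adj] : ℕ :=
  ⨅ S : Finset V, #Sᶜ + #(S.biUnion fun i ↦ G.neighborFinset i)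

theorem doubleCoverNumber_le_card (G : SimpleGraph V) [DecidableRel G.Adj] :
    doubleCoverNumber G ≤ Fintype.card V :=
  (ciInf_le' _ ∅).trans (by simp)

theorem doubleCoverNumber_mono (hGH : G ≤ H) : doubleCoverNumber G ≤ doubleCoverNumber H :=
  ciInf_mono (OrderBot.bddBelow _) fun _ ↦ add_le_add_right (card_le_card <| biUnion_mono fun i _ ↦
    Set.toFinset_subset_toFinset.2 (SimpleGraph.neighborSet_mono hGH i)) _

theorem exists_matching [Nonempty V] (G : SimpleGraph V) [DecidableRel G.Adj] :
    ∃ (M : Finset V) (g : V → V),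
      Set.InjOn g M ∧ (∀ i ∈ M, G.Adj i (g i)) ∧ doubleCoverNumber G ≤ #M := by
  have hcard := doubleCoverNumber_le_card G
  obtain ⟨M, g, hg, hadj, hM⟩ := exists_injOn_of_card_le_card_biUnion_add
    (fun i ↦ G.neighborFinset i) (Fintype.card V - doubleCoverNumber G) fun S ↦ by
      have hS : doubleCoverNumber G ≤ #Sᶜ + #(S.biUnion fun i ↦ G.neighborFinset i) := ciInf_le' _ S
      have := card_add_card_compl S
      omega
  exact ⟨M, g, hg, fun i hi ↦ (G.mem_neighborFinset i _).1 (hadj i hi), by omega⟩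

/-- The fractional stable sets of maximum total weight, the maximum being given by linear
programming duality. -/
def maxFracStable (G : SimpleGraph V) [DecidableRel G.Adj] : Set (V → ℝ) :=
  {x ∈ fracStable G | 2 * ∑ i, x i + doubleCoverNumber G = 2 * Fintype.card V}

theorem maxFracStable_nonempty (G : SimpleGraph V) [DecidableRel G.Adj] :
    (maxFracStable G).Nonempty := by
  obtain ⟨S, hS⟩ := exists_eq_ciInf_of_finite
    (f := fun S : Finset V ↦ #Sᶜ + #(S.biUnion fun i ↦ G.neighborFinset i))
  let N := S.biUnion fun i ↦ G.neighborFinset i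
  let x : V → ℝ := fun i ↦ ((if i ∈ S then 1 else 0) + (if i ∈ Nᶜ then 1 else 0)) / 2
  refine ⟨x, ⟨fun i ↦ ?_, fun i j hij ↦ ?_⟩, ?_⟩
  · simp only [x, Set.mem_Icc]
    split_ifs <;> norm_num
  · have hij' : i ∈ S → j ∈ N := fun hi ↦ by simpa [N] using ⟨i, hi, hij⟩
    have hji' : j ∈ S → i ∈ N := fun hj ↦ by simpa [N] using ⟨j, hj, hij.symm⟩
    simp only [x, mem_compl]
    grind
  · have hsum : 2 * ∑ i, x i = #S + #Nᶜ := by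
      simp only [x, ← sum_div, sum_add_distrib, sum_boole, filter_univ_mem]
      ring
    have hcover : (#Sᶜ + #N : ℝ) = doubleCoverNumber G := by exact_mod_cast hS
    have hS' : (#S + #Sᶜ : ℝ) = Fintype.card V := by exact_mod_cast card_add_card_compl S
    have hN' : (#N + #Nᶜ : ℝ) = Fintype.card V := by exact_mod_cast card_add_card_compl N
    linarith

theorem sum_slack (hg : Set.InjOn g M) (x : V → ℝ) :
    ∑ i ∈ M, (1 - x i - x (g i)) + ∑ i ∈ Mᶜ, (1 - x i) + ∑ j ∈ (M.image g)ᶜ, (1 - x j)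
      = 2 * Fintype.card V - #M - 2 * ∑ i, x i := by
  have hM := sum_add_sum_compl M fun i ↦ 1 - x i
  have hgM := sum_add_sum_compl (M.image g) fun i ↦ 1 - x i
  rw [sum_image hg] at hgM
  simp only [sum_sub_distrib, sum_const, card_univ, nsmul_eq_mul, mul_one] at *
  linarith

theorem complementary_slackness (hx : x ∈ maxFracStable G) (hg : Set.InjOn g M)
    (hadj : ∀ i ∈ M, G.Adj i (g i)) (hM : doubleCoverNumber G ≤ #M) :
    #M = doubleCoverNumber G ∧ (∀ i ∈ M, x i + x (g i) = 1) ∧ ∀ i ∉ M, x i = 1 := by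
  obtain ⟨⟨hx01, hxadj⟩, hsum⟩ := hx
  have hslack := sum_slack hg x
  have edge_slack : ∀ i ∈ M, 0 ≤ 1 - x i - x (g i) := fun i hi ↦ by
    linarith [hxadj (hadj i hi)]
  have vertex_slack (s : Finset V) : ∀ i ∈ s, 0 ≤ 1 - x i := fun i _ ↦ by
    linarith [(hx01 i).2]
  have edge_sum := sum_nonneg edge_slack
  have vertex_sum := sum_nonneg (vertex_slack Mᶜ)
  have image_sum := sum_nonneg (vertex_slack (M.image g)ᶜ)
  have hM' : (doubleCoverNumber G : ℝ) ≤ #M := by exact_mod_cast hM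
  refine ⟨hM.antisymm' ?_, fun i hi ↦ ?_, fun i hi ↦ ?_⟩
  · have : (#M : ℝ) ≤ doubleCoverNumber G := by linarith
    exact_mod_cast this
  · linarith [(sum_eq_zero_iff_of_nonneg edge_slack).1 (by linarith) i hi]
  · linarith [(sum_eq_zero_iff_of_nonneg (vertex_slack Mᶜ)).1 (by linarith) i (mem_compl.2 hi)]

/-- The linear span of the face of optimal points of the fractional stable set polytope. -/
def optimalSpan (G : SimpleGraph V) [DecidableRel G.Adj] : Submodule ℝ (V → ℝ) :=
  Submodule.span ℝ (maxFracStable G)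

theorem finrank_optimalSpan_le [Nonempty V] (G : SimpleGraph V) [DecidableRel G.Adj] :
    Module.finrank ℝ (optimalSpan G) ≤ doubleCoverNumber G / 2 + 1 := by
  obtain ⟨M, g, hg, hadj, hM⟩ := exists_matching G
  obtain ⟨x₀, hx₀⟩ := maxFracStable_nonempty G
  obtain ⟨hcard, hx₀M, hx₀c⟩ := complementary_slackness hx₀ hg hadj hM
  have hle : optimalSpan G ≤ Submodule.span ℝ {x₀} ⊔ alternating ℝ M g := by
    refine Submodule.span_le.2 fun x hx ↦ ?_
    obtain ⟨-, hxM, hxc⟩ := complementary_slackness hx hg hadj hM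
    refine Submodule.mem_sup.2 ⟨x₀, Submodule.mem_span_singleton_self x₀, x - x₀,
      ⟨fun i hi ↦ ?_, fun i hi ↦ ?_⟩, add_sub_cancel x₀ x⟩
    · simp only [Pi.sub_apply]
      linarith [hxM i hi, hx₀M i hi]
    · simp only [Pi.sub_apply, hxc i hi, hx₀c i hi, sub_self]
  have hsup := Submodule.finrank_add_le_finrank_add_finrank (Submodule.span ℝ {x₀})
    (alternating ℝ M g)
  have hline : Module.finrank ℝ (Submodule.span ℝ {x₀}) ≤ 1 := by
    simpa using finrank_span_le_card (R := ℝ) {x₀}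
  have halt := two_mul_finrank_alternating_le (K := ℝ) hg fun i hi ↦ (hadj i hi).ne'
  have := Submodule.finrank_mono hle
  omega

theorem sum_pos_of_mem_maxFracStable [Nonempty V] (hx : x ∈ maxFracStable G) :
    0 < ∑ i, x i := by
  have hcard : (doubleCoverNumber G : ℝ) ≤ Fintype.card V := by
    exact_mod_cast doubleCoverNumber_le_card G
  have hpos : (0 : ℝ) < Fintype.card V := by exact_mod_cast Fintype.card_pos
  linarith [hx.2]

theorem finrank_optimalSpan_pos [Nonempty V] (G : SimpleGraph V) [DecidableRel G.Adj] :
    0 < Module.finrank ℝ (optimalSpan G) := by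
  obtain ⟨x, hx⟩ := maxFracStable_nonempty G
  refine Nat.pos_of_ne_zero fun h ↦ ?_
  have hmem : x ∈ optimalSpan G := Submodule.subset_span hx
  rw [Submodule.finrank_eq_zero.1 h, Submodule.mem_bot] at hmem
  simpa [hmem] using sum_pos_of_mem_maxFracStable hx

end FractionalStableSets

section Potential

variable {V : Type*} [Fintype V] [DecidableEq V] {G H : SimpleGraph V} [DecidableRel G.Adj]
  [DecidableRel H.Adj]

/-- The potential of `G` bounds the length of a chain of graphs starting at `G` along which either
the cover number increases or, the cover number being constant, the dimension of the optimal span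
decreases: for the cover number `m` there are at most `m / 2 + 1` such dimensions. -/
noncomputable def potential (G : SimpleGraph V) [DecidableRel G.Adj] : ℕ :=
  Module.finrank ℝ (optimalSpan G) +
    ∑ m ∈ Ioc (doubleCoverNumber G) (Fintype.card V), (m / 2 + 1)

theorem potential_pos [Nonempty V] (G : SimpleGraph V) [DecidableRel G.Adj] : 0 < potential G :=
  Nat.add_pos_left (finrank_optimalSpan_pos G) _

theorem potential_lt_of_doubleCoverNumber_lt [Nonempty V]
    (h : doubleCoverNumber G < doubleCoverNumber H) : potential H < potential G := by
  have hrank := finrank_optimalSpan_le H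
  have hpos := finrank_optimalSpan_pos G
  have hlevel : doubleCoverNumber H / 2 + 1 ≤
      ∑ m ∈ Ioc (doubleCoverNumber G) (doubleCoverNumber H), (m / 2 + 1) :=
    single_le_sum (f := fun m ↦ m / 2 + 1) (fun _ _ ↦ Nat.zero_le _) (right_mem_Ioc.2 h)
  rw [potential, potential,
    ← sum_Ioc_consecutive (fun m ↦ m / 2 + 1) h.le (doubleCoverNumber_le_card H)]
  omega

theorem four_mul_sum_Icc_div_two_add_one {d n : ℕ} (h : 2 * d ≤ n) :
    4 * ∑ m ∈ Icc (2 * d) n, (m / 2 + 1) + 4 * d ^ 2 + 4 * d + n % 2 = (n + 2) ^ 2 := by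
  induction n, h using Nat.le_induction with
  | base =>
    simp only [Icc_self, sum_singleton]
    grind
  | succ n hn ih =>
    rw [sum_Icc_succ_top (by omega)]
    grind

theorem four_mul_potential_add_le [Nonempty V] {d : ℕ} (h : 2 * d ≤ doubleCoverNumber G) :
    4 * potential G + 4 * d ^ 2 + 4 * d ≤ (Fintype.card V + 2) ^ 2 := by
  have hcard := doubleCoverNumber_le_card G
  have hrank := finrank_optimalSpan_le G
  have hlevels : potential G ≤ ∑ m ∈ Icc (2 * d) (Fintype.card V), (m / 2 + 1) := calc
    potential G ≤ ∑ m ∈ Icc (doubleCoverNumber G) (Fintype.card V), (m / 2 + 1) := by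
      rw [potential, ← add_sum_Ioc_eq_sum_Icc (f := fun m ↦ m / 2 + 1) hcard]
      gcongr
    _ ≤ _ := sum_le_sum_of_subset (Icc_subset_Icc_left h)
  have := four_mul_sum_Icc_div_two_add_one (h.trans hcard)
  omega

end Potential

section Words

variable {V : Type*} {Φ : Set (V → V)} {s t : ℕ} {f v w : V → V} {i j : V}

/-- `IsWordMap Φ t w`: the transformation `w` is induced by a word of length at most `t` over the
alphabet `Φ`. -/
inductive IsWordMap (Φ : Set (V → V)) : ℕ → (V → V) → Prop
  | nil (t : ℕ) : IsWordMap Φ t id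
  | cons {t : ℕ} {w f : V → V} : f ∈ Φ → IsWordMap Φ t w → IsWordMap Φ (t + 1) (w ∘ f)

theorem IsWordMap.mono (hst : s ≤ t) (hw : IsWordMap Φ s w) : IsWordMap Φ t w := by
  induction hw generalizing t with
  | nil => exact nil t
  | cons hf _ ih =>
    obtain ⟨t, rfl⟩ := Nat.exists_eq_add_of_le' ((Nat.succ_pos _).trans_le hst)
    exact cons hf (ih (Nat.succ_le_succ_iff.1 hst))

theorem IsWordMap.comp (hv : IsWordMap Φ s v) (hw : IsWordMap Φ t w) :
    IsWordMap Φ (s + t) (w ∘ v) := by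
  induction hv with
  | nil s => exact hw.mono (Nat.le_add_left t s)
  | @cons s v f hf _ ih => exact Nat.add_right_comm s t 1 ▸ cons (w := w ∘ v) hf ih

theorem IsWordMap.letter (hf : f ∈ Φ) : IsWordMap Φ 1 f :=
  cons (w := id) hf (nil 0)

/-- Some word maps all states to one state. -/
def Synchronizing (Φ : Set (V → V)) : Prop :=
  ∃ (t : ℕ) (w : V → V) (z : V), IsWordMap Φ t w ∧ ∀ i, w i = z

/-- Every state can be reached from every state by applying letters. -/
def StronglyConnected (Φ : Set (V → V)) : Prop :=
  ∀ i j : V, Relation.ReflTransGen (fun a b ↦ ∃ f ∈ Φ, f a = b) i j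

theorem Synchronizing.exists_noninjective_letter [Nontrivial V] (hs : Synchronizing Φ) :
    ∃ f ∈ Φ, ¬ Function.Injective f := by
  by_contra! hinj
  have word_injective {t w} (hw : IsWordMap Φ t w) : Function.Injective w := by
    induction hw with
    | nil => exact Function.injective_id
    | cons hf _ ih => exact ih.comp (hinj _ hf)
  obtain ⟨t, w, z, hw, hz⟩ := hs
  obtain ⟨a, b, hab⟩ := exists_pair_ne V
  exact hab (word_injective hw ((hz a).trans (hz b).symm))

/-- No word of length at most `b` maps three distinct states to one state. -/
def TripleFree (Φ : Set (V → V)) (b : ℕ) : Prop :=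
  ∀ ⦃w⦄, IsWordMap Φ b w → ∀ ⦃i j k⦄, w i = w j → w i = w k → i = j ∨ i = k ∨ j = k

theorem TripleFree.mono (hst : s ≤ t) (h : TripleFree Φ t) : TripleFree Φ s :=
  fun _ hw ↦ h (hw.mono hst)

theorem TripleFree.card_fiber_le_two [Fintype V] [DecidableEq V] (h : TripleFree Φ t)
    (hw : IsWordMap Φ t w) (j : V) : #{i | w i = j} ≤ 2 := by
  by_contra! hcard
  obtain ⟨i, hi, i', hi', k, hk, hii', hik, hi'k⟩ := two_lt_card.1 hcard
  simp only [mem_filter_univ] at hi hi' hk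
  rcases h hw (hi.trans hi'.symm) (hi.trans hk.symm) with h | h | h <;> contradiction

end Words

section MergeGraph

variable {V : Type*} {Φ : Set (V → V)} {s t : ℕ} {f : V → V} {i j : V}

/-- The graph joining two distinct states when some word of length at most `t` merges them. -/
def mergeGraph (Φ : Set (V → V)) (t : ℕ) : SimpleGraph V where
  Adj i j := i ≠ j ∧ ∃ w, IsWordMap Φ t w ∧ w i = w j
  symm := ⟨fun _ _ ⟨hij, w, hw, e⟩ ↦ ⟨hij.symm, w, hw, e.symm⟩⟩
  loopless := ⟨fun _ h ↦ h.1 rfl⟩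

noncomputable instance : DecidableRel (mergeGraph Φ t).Adj := Classical.decRel _

theorem mergeGraph_mono (Φ : Set (V → V)) : Monotone (mergeGraph Φ) :=
  fun _ _ hst _ _ ⟨hij, w, hw, e⟩ ↦ ⟨hij, w, hw.mono hst, e⟩

theorem mergeGraph_succ_adj_iff :
    (mergeGraph Φ (t + 1)).Adj i j ↔
      i ≠ j ∧ ∃ f ∈ Φ, f i = f j ∨ (mergeGraph Φ t).Adj (f i) (f j) := by
  refine and_congr_right fun hij ↦ ⟨?_, ?_⟩
  · rintro ⟨w, hw, e⟩
    cases hw with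
    | nil => exact absurd e hij
    | @cons _ w f hf hw => exact ⟨f, hf, or_iff_not_imp_left.2 fun h ↦ ⟨h, w, hw, e⟩⟩
  · rintro ⟨f, hf, h | ⟨-, w, hw, e⟩⟩
    · exact ⟨f, (IsWordMap.letter hf).mono (Nat.le_add_left 1 t), h⟩
    · exact ⟨w ∘ f, .cons hf hw, e⟩

theorem mergeGraph_add_eq (h : mergeGraph Φ (t + 1) = mergeGraph Φ t) (k : ℕ) :
    mergeGraph Φ (t + k) = mergeGraph Φ t := by
  induction k with
  | zero => rfl
  | succ k ih =>
    rw [← h]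
    ext i j
    rw [← add_assoc, mergeGraph_succ_adj_iff, mergeGraph_succ_adj_iff, ih]

theorem Synchronizing.eq_top_of_mergeGraph_succ_eq (hs : Synchronizing Φ)
    (h : mergeGraph Φ (t + 1) = mergeGraph Φ t) : mergeGraph Φ t = ⊤ := by
  obtain ⟨r, w, z, hw, hz⟩ := hs
  refine top_le_iff.1 fun i j hij ↦ ?_
  rw [← mergeGraph_add_eq h r]
  exact ⟨hij, w, hw.mono (Nat.le_add_left r t), (hz i).trans (hz j).symm⟩

variable [Fintype V]

theorem TripleFree.mergeGraph_lt_succ (h : TripleFree Φ (t + 1)) (hs : Synchronizing Φ)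
    (hV : 3 ≤ Fintype.card V) : mergeGraph Φ t < mergeGraph Φ (t + 1) := by
  classical
  refine lt_of_le_of_ne (mergeGraph_mono Φ t.le_succ) fun heq ↦ ?_
  have htop := hs.eq_top_of_mergeGraph_succ_eq heq.symm
  have : Nontrivial V := Fintype.one_lt_card_iff_nontrivial.1 (Nat.lt_of_succ_lt hV)
  obtain ⟨f, hf, hinj⟩ := hs.exists_noninjective_letter
  obtain ⟨a, c, hfac, hac⟩ := Function.not_injective_iff.1 hinj
  obtain ⟨x, -, hx⟩ : ∃ x ∈ univ, x ∉ ({a, c} : Finset V) :=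
    exists_mem_notMem_of_card_lt_card (card_le_two.trans_lt hV)
  obtain ⟨hxa, hxc⟩ : a ≠ x ∧ c ≠ x := by simpa [eq_comm] using hx
  by_cases hfx : f a = f x
  · exact absurd (h (.cons hf (.nil t)) hfac hfx) (by simp [hac, hxa, hxc])
  · obtain ⟨-, w, hw, e⟩ : (mergeGraph Φ t).Adj (f a) (f x) := htop ▸ hfx
    exact absurd (h (.cons hf hw) (congrArg w hfac) e) (by simp [hac, hxa, hxc])

theorem TripleFree.le_card_edgeFinset (h : TripleFree Φ t) (hs : Synchronizing Φ)
    (hV : 3 ≤ Fintype.card V) : t ≤ #(mergeGraph Φ t).edgeFinset := by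
  induction t with
  | zero => exact Nat.zero_le _
  | succ t ih =>
    have hlt := SimpleGraph.edgeFinset_ssubset_edgeFinset.2 (h.mergeGraph_lt_succ hs hV)
    exact (ih (h.mono t.le_succ)).trans_lt (card_lt_card hlt)

theorem TripleFree.two_mul_le_sum_degree (h : TripleFree Φ t) (hs : Synchronizing Φ)
    (hV : 3 ≤ Fintype.card V) : 2 * t ≤ ∑ i, (mergeGraph Φ t).degree i := by
  classical
  rw [SimpleGraph.sum_degrees_eq_twice_card_edges]
  exact Nat.mul_le_mul_left 2 (h.le_card_edgeFinset hs hV)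

theorem TripleFree.two_mul_le (h : TripleFree Φ t) (hs : Synchronizing Φ)
    (hV : 3 ≤ Fintype.card V) : 2 * t ≤ Fintype.card V * (Fintype.card V - 1) := by
  refine (h.two_mul_le_sum_degree hs hV).trans ?_
  rw [← smul_eq_mul, ← card_univ]
  exact sum_le_card_nsmul _ _ _ fun i _ ↦
    Nat.le_sub_one_of_lt (SimpleGraph.degree_lt_card_verts _)

end MergeGraph

section Push

variable {V K : Type*} [Fintype V] [DecidableEq V] [Field K] {Φ : Set (V → V)} {t : ℕ}
  {f w : V → V}

/-- The linear map moving the weight of every state `i` to the state `f i`. -/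
noncomputable def push (f : V → V) : (V → K) →ₗ[K] (V → K) :=
  Fintype.linearCombination K fun i ↦ Pi.single (f i) 1

theorem push_apply (f : V → V) (x : V → K) (j : V) : push f x j = ∑ i with f i = j, x i := by
  simp [push, Fintype.linearCombination_apply, Pi.single_apply, sum_filter, eq_comm]

theorem push_single (f : V → V) (i : V) : push f (Pi.single i (1 : K)) = Pi.single (f i) 1 := by
  simp [push]

theorem push_id : push (K := K) (id : V → V) = LinearMap.id :=
  LinearMap.pi_ext' fun i ↦ LinearMap.ext_ring (by simp [push_single])

theorem push_comp (w f : V → V) : push (K := K) (w ∘ f) = push w ∘ₗ push f :=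
  LinearMap.pi_ext' fun i ↦ LinearMap.ext_ring (by simp [push_single])

theorem sum_push (f : V → V) (x : V → K) : ∑ j, push f x j = ∑ i, x i := by
  simp only [push_apply]
  exact sum_fiberwise univ f x

theorem push_eq_smul_single {z : V} (hw : ∀ i, w i = z) (x : V → K) :
    push w x = (∑ i, x i) • Pi.single z (1 : K) := by
  ext j
  obtain rfl | hj := eq_or_ne z j <;> simp [push_apply, *]

theorem IsWordMap.le_comap_push {W : Submodule K (V → K)}
    (hW : ∀ f ∈ Φ, W ≤ W.comap (push f)) (hw : IsWordMap Φ t w) : W ≤ W.comap (push w) := by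
  induction hw with
  | nil => rw [push_id, Submodule.comap_id]
  | cons hf _ ih =>
    rw [push_comp, Submodule.comap_comp]
    exact (hW _ hf).trans (Submodule.comap_mono ih)

/-- A reset word turns a weight of nonzero sum into a multiple of a basis vector, which the letters
then carry to all other basis vectors. -/
theorem eq_top_of_le_comap_push (hs : Synchronizing Φ) (hc : StronglyConnected Φ)
    {W : Submodule K (V → K)} (hW : ∀ f ∈ Φ, W ≤ W.comap (push f)) {x : V → K} (hx : x ∈ W)
    (hsum : ∑ i, x i ≠ 0) : W = ⊤ := by
  obtain ⟨r, w, z, hw, hz⟩ := hs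
  have single_mem_reset : Pi.single z 1 ∈ W := by
    have hmem := hw.le_comap_push hW hx
    rwa [Submodule.mem_comap, push_eq_smul_single hz, Submodule.smul_mem_iff _ hsum] at hmem
  have single_mem (i : V) : Pi.single i 1 ∈ W := by
    induction hc z i with
    | refl => exact single_mem_reset
    | tail _ hstep ih =>
      obtain ⟨f, hf, rfl⟩ := hstep
      exact push_single (K := K) f _ ▸ hW f hf ih
  refine Submodule.eq_top_iff'.2 fun y ↦ ?_
  rw [pi_eq_sum_univ' y]
  exact Submodule.sum_mem _ fun i _ ↦ Submodule.smul_mem _ _ (single_mem i)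

theorem push_nonneg {x : V → ℝ} (hx : ∀ i, 0 ≤ x i) (j : V) : 0 ≤ push f x j := by
  rw [push_apply]
  exact sum_nonneg fun i _ ↦ hx i

theorem add_le_push {x : V → ℝ} (hx : ∀ i, 0 ≤ x i) {i j : V} (hij : i ≠ j) (e : w i = w j) :
    x i + x j ≤ push w x (w i) := by
  rw [push_apply, ← sum_pair hij]
  exact sum_le_sum_of_subset_of_nonneg (by simp [insert_subset_iff, e]) fun k _ _ ↦ hx k

theorem TripleFree.push_le_one {x : V → ℝ} (h : TripleFree Φ t) (hw : IsWordMap Φ t w)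
    (hx : x ∈ fracStable (mergeGraph Φ t)) (j : V) : push w x j ≤ 1 := by
  rw [push_apply]
  have hcard := h.card_fiber_le_two hw j
  interval_cases hc : #{i | w i = j}
  · simp [card_eq_zero.1 hc]
  · obtain ⟨i, hi⟩ := card_eq_one.1 hc
    rw [hi, sum_singleton]
    exact (hx.1 i).2
  · obtain ⟨i, k, hik, hfib⟩ := card_eq_two.1 hc
    have hi : w i = j := mem_filter_univ i |>.1 (hfib ▸ mem_insert_self i {k})
    have hk : w k = j := mem_filter_univ k |>.1 (hfib ▸ mem_insert_of_mem (mem_singleton_self k))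
    rw [hfib, sum_pair hik]
    exact hx.2 ⟨hik, w, hw, hi.trans hk.symm⟩

theorem TripleFree.push_mem_fracStable {x : V → ℝ} (h : TripleFree Φ (t + 1)) (hf : f ∈ Φ)
    (hx : x ∈ fracStable (mergeGraph Φ (t + 1))) : push f x ∈ fracStable (mergeGraph Φ t) := by
  have hx₀ : ∀ i, 0 ≤ x i := fun i ↦ (hx.1 i).1
  refine ⟨fun j ↦ ⟨push_nonneg hx₀ j, h.push_le_one (.cons hf (.nil t)) hx j⟩, ?_⟩
  rintro i j ⟨hij, w, hw, e⟩
  calc push f x i + push f x j ≤ push w (push f x) (w i) := add_le_push (push_nonneg hx₀) hij e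
    _ = push (w ∘ f) x (w i) := by rw [push_comp, LinearMap.comp_apply]
    _ ≤ 1 := h.push_le_one (.cons hf hw) hx _

theorem TripleFree.two_mul_card_le (h : TripleFree Φ t) (hw : IsWordMap Φ t w) :
    2 * Fintype.card V ≤ 2 * #(univ.image w) + doubleCoverNumber (mergeGraph Φ t) := by
  obtain ⟨x, hx, hsum⟩ := maxFracStable_nonempty (mergeGraph Φ t)
  have hle : ∑ i, x i ≤ #(univ.image w) := calc
    ∑ i, x i = ∑ j ∈ univ.image w, push w x j := by
      simp only [push_apply]
      exact (sum_fiberwise_of_maps_to (fun i _ ↦ mem_image_of_mem w (mem_univ i)) x).symm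
    _ ≤ ∑ j ∈ univ.image w, 1 := sum_le_sum fun j _ ↦ h.push_le_one hw hx j
    _ = #(univ.image w) := by simp
  have : (2 * Fintype.card V : ℝ) ≤ 2 * #(univ.image w) + doubleCoverNumber (mergeGraph Φ t) := by
    linarith
  exact_mod_cast this

theorem TripleFree.finrank_optimalSpan_lt (h : TripleFree Φ (t + 1)) (hs : Synchronizing Φ)
    (hc : StronglyConnected Φ) (hV : 3 ≤ Fintype.card V)
    (hcover : doubleCoverNumber (mergeGraph Φ t) = doubleCoverNumber (mergeGraph Φ (t + 1))) :
    Module.finrank ℝ (optimalSpan (mergeGraph Φ (t + 1))) <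
      Module.finrank ℝ (optimalSpan (mergeGraph Φ t)) := by
  have : Nonempty V := Fintype.card_pos_iff.1 (by omega)
  have hle : optimalSpan (mergeGraph Φ (t + 1)) ≤ optimalSpan (mergeGraph Φ t) :=
    Submodule.span_mono fun x hx ↦
      ⟨fracStable_anti (mergeGraph_mono Φ t.le_succ) hx.1, by rw [hcover, hx.2]⟩
  refine (Submodule.finrank_mono hle).lt_of_ne fun hrank ↦ ?_
  have heq := Submodule.eq_of_le_of_finrank_eq hle hrank
  have hpush : ∀ f ∈ Φ, optimalSpan (mergeGraph Φ (t + 1)) ≤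
      (optimalSpan (mergeGraph Φ t)).comap (push f) := fun f hf ↦
    Submodule.span_le.2 fun x hx ↦ Submodule.subset_span
      ⟨h.push_mem_fracStable hf hx.1, by rw [sum_push, hcover, hx.2]⟩
  rw [heq] at hpush
  obtain ⟨x, hx⟩ := maxFracStable_nonempty (mergeGraph Φ t)
  have htop := eq_top_of_le_comap_push hs hc hpush (Submodule.subset_span hx)
    (sum_pos_of_mem_maxFracStable hx).ne'
  have hfinrank := finrank_optimalSpan_le (mergeGraph Φ t)
  have hcard := doubleCoverNumber_le_card (mergeGraph Φ t)
  rw [htop, finrank_top, Module.finrank_fintype_fun_eq_card] at hfinrank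
  omega

theorem TripleFree.potential_lt (h : TripleFree Φ (t + 1)) (hs : Synchronizing Φ)
    (hc : StronglyConnected Φ) (hV : 3 ≤ Fintype.card V) :
    potential (mergeGraph Φ (t + 1)) < potential (mergeGraph Φ t) := by
  have : Nonempty V := Fintype.card_pos_iff.1 (by omega)
  obtain hlt | heq := (doubleCoverNumber_mono (mergeGraph_mono Φ t.le_succ)).lt_or_eq
  · exact potential_lt_of_doubleCoverNumber_lt hlt
  · rw [potential, potential, heq]
    exact Nat.add_lt_add_right (h.finrank_optimalSpan_lt hs hc hV heq) _

theorem TripleFree.succ_le_add_potential {b : ℕ} (h : TripleFree Φ b) (hs : Synchronizing Φ)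
    (hc : StronglyConnected Φ) (hV : 3 ≤ Fintype.card V) (htb : t ≤ b) :
    b + 1 ≤ t + potential (mergeGraph Φ t) := by
  have : Nonempty V := Fintype.card_pos_iff.1 (by omega)
  induction htb using Nat.decreasingInduction with
  | self => exact Nat.add_le_add_left (potential_pos _) b
  | of_succ t ht ih =>
    have := (h.mono ht).potential_lt hs hc hV
    omega

end Push

section Depth

variable {V : Type*} [Fintype V] {Φ : Set (V → V)} {b i j k t : ℕ} {f w : V → V} {v : V}

open scoped Classical in
/-- The states with two distinct preimages under some word of length at most `j`. -/
noncomputable def doubled (Φ : Set (V → V)) (j : ℕ) : Finset V :=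
  {v | ∃ w, IsWordMap Φ j w ∧ ∃ a c, a ≠ c ∧ w a = v ∧ w c = v}

theorem mem_doubled_iff :
    v ∈ doubled Φ j ↔ ∃ w, IsWordMap Φ j w ∧ ∃ a c, a ≠ c ∧ w a = v ∧ w c = v := by
  classical exact mem_filter_univ v

theorem doubled_mono (Φ : Set (V → V)) : Monotone (doubled Φ) := fun _ _ hij v hv ↦ by
  obtain ⟨w, hw, h⟩ := mem_doubled_iff.1 hv
  exact mem_doubled_iff.2 ⟨w, hw.mono hij, h⟩

theorem apply_mem_doubled_succ (hf : f ∈ Φ) (hv : v ∈ doubled Φ j) : f v ∈ doubled Φ (j + 1) := by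
  obtain ⟨w, hw, a, c, hac, ha, hc⟩ := mem_doubled_iff.1 hv
  exact mem_doubled_iff.2
    ⟨f ∘ w, hw.comp (.letter hf), a, c, hac, congrArg f ha, congrArg f hc⟩

theorem Synchronizing.doubled_one_nonempty [Nontrivial V] (hs : Synchronizing Φ) :
    (doubled Φ 1).Nonempty := by
  obtain ⟨f, hf, hinj⟩ := hs.exists_noninjective_letter
  obtain ⟨a, c, hfac, hac⟩ := Function.not_injective_iff.1 hinj
  exact ⟨f a, mem_doubled_iff.2 ⟨f, .letter hf, a, c, hac, rfl, hfac.symm⟩⟩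

theorem StronglyConnected.eq_univ (hc : StronglyConnected Φ) {s : Finset V} (hne : s.Nonempty)
    (h : ∀ f ∈ Φ, ∀ v ∈ s, f v ∈ s) : s = univ := by
  obtain ⟨v, hv⟩ := hne
  refine eq_univ_of_forall fun u ↦ ?_
  induction hc v u with
  | refl => exact hv
  | tail _ hstep ih =>
    obtain ⟨f, hf, rfl⟩ := hstep
    exact h f hf _ ih

theorem doubled_ssubset_succ [Nontrivial V] (hs : Synchronizing Φ) (hc : StronglyConnected Φ)
    (hj : doubled Φ j ≠ univ) : doubled Φ j ⊂ doubled Φ (j + 1) := by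
  refine (doubled_mono Φ j.le_succ).ssubset_of_ne fun heq ↦ hj (hc.eq_univ ?_ fun f hf v hv ↦ ?_)
  · rw [heq]
    exact hs.doubled_one_nonempty.mono (doubled_mono Φ (Nat.le_add_left 1 j))
  · rw [heq]
    exact apply_mem_doubled_succ hf hv

theorem card_doubled_add_le_of_ne_univ [Nontrivial V] (hs : Synchronizing Φ)
    (hc : StronglyConnected Φ) (hik : i ≤ k) (h : ∀ j < k, doubled Φ j ≠ univ) :
    #(doubled Φ i) + (k - i) ≤ #(doubled Φ k) := by
  induction k, hik using Nat.le_induction with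
  | base => rw [Nat.sub_self, Nat.add_zero]
  | succ k hik ih =>
    have := ih fun j hj ↦ h j (hj.trans k.lt_succ_self)
    have := card_lt_card (doubled_ssubset_succ hs hc (h k k.lt_succ_self))
    omega

theorem exists_doubled_eq_univ [Nontrivial V] (hs : Synchronizing Φ) (hc : StronglyConnected Φ) :
    ∃ k, doubled Φ k = univ := by
  by_contra! hne
  have hgrow := card_doubled_add_le_of_ne_univ hs hc (Nat.zero_le (Fintype.card V + 1))
    fun j _ ↦ hne j
  have := card_le_univ (doubled Φ (Fintype.card V + 1))
  omega

/-- The length of a shortest word under which `v` has two distinct preimages. -/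
noncomputable def depth (Φ : Set (V → V)) (v : V) : ℕ :=
  sInf {j | v ∈ doubled Φ j}

/-- The largest depth of a state, as the least `k` for which every state is doubled by words of
length at most `k`. -/
noncomputable def maxDepth (Φ : Set (V → V)) : ℕ :=
  sInf {k | doubled Φ k = univ}

variable [Nontrivial V]

theorem doubled_maxDepth (hs : Synchronizing Φ) (hc : StronglyConnected Φ) :
    doubled Φ (maxDepth Φ) = univ :=
  Nat.sInf_mem (exists_doubled_eq_univ hs hc)

theorem mem_doubled_maxDepth (hs : Synchronizing Φ) (hc : StronglyConnected Φ) (v : V) :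
    v ∈ doubled Φ (maxDepth Φ) :=
  doubled_maxDepth hs hc ▸ mem_univ v

theorem depth_le_iff (hs : Synchronizing Φ) (hc : StronglyConnected Φ) :
    depth Φ v ≤ j ↔ v ∈ doubled Φ j :=
  ⟨fun h ↦ doubled_mono Φ h <|
    Nat.sInf_mem (s := {j | v ∈ doubled Φ j}) ⟨_, mem_doubled_maxDepth hs hc v⟩,
    fun h ↦ Nat.sInf_le h⟩

theorem depth_le_maxDepth (hs : Synchronizing Φ) (hc : StronglyConnected Φ) (v : V) :
    depth Φ v ≤ maxDepth Φ :=
  (depth_le_iff hs hc).2 (mem_doubled_maxDepth hs hc v)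

theorem card_doubled_add_le (hs : Synchronizing Φ) (hc : StronglyConnected Φ) (hik : i ≤ k)
    (hk : k ≤ maxDepth Φ) : #(doubled Φ i) + (k - i) ≤ #(doubled Φ k) :=
  card_doubled_add_le_of_ne_univ hs hc hik fun _ hj ↦ Nat.notMem_of_lt_sInf (hj.trans_le hk)

theorem le_card_doubled (hs : Synchronizing Φ) (hc : StronglyConnected Φ)
    (hk : k ≤ maxDepth Φ) : k ≤ #(doubled Φ k) :=
  (Nat.le_add_left _ _).trans (card_doubled_add_le hs hc k.zero_le hk)

theorem maxDepth_le_card (hs : Synchronizing Φ) (hc : StronglyConnected Φ) :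
    maxDepth Φ ≤ Fintype.card V :=
  (le_card_doubled hs hc le_rfl).trans (card_le_univ _)

theorem exists_depth_eq_succ (hs : Synchronizing Φ) (hc : StronglyConnected Φ)
    (hj : j < maxDepth Φ) : ∃ v, depth Φ v = j + 1 := by
  obtain ⟨v, hv, hv'⟩ := exists_of_ssubset (doubled_ssubset_succ hs hc (Nat.notMem_of_lt_sInf hj))
  rw [← depth_le_iff hs hc] at hv hv'
  exact ⟨v, by omega⟩

end Depth

section Degree

variable {V : Type*} [Fintype V] {Φ : Set (V → V)} {b j t : ℕ} {w : V → V} {v : V}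

theorem TripleFree.degree_add_card_image_le [DecidableEq V] (h : TripleFree Φ b)
    (hw : IsWordMap Φ j w) {a c : V} (hac : a ≠ c) (ha : w a = v) (hc : w c = v)
    (htj : t + j ≤ b) : (mergeGraph Φ t).degree v + #(univ.image w) ≤ Fintype.card V := by
  have hdisj : Disjoint ((mergeGraph Φ t).neighborFinset v) (univ.image w) := by
    refine disjoint_left.2 fun u hu hu' ↦ ?_
    obtain ⟨k, -, rfl⟩ := mem_image.1 hu'
    obtain ⟨hne, w', hw', e⟩ := (SimpleGraph.mem_neighborFinset _ _ _).1 hu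
    have hword := (hw.comp hw').mono ((Nat.add_comm j t).trans_le htj)
    rcases h hword (i := a) (j := c) (k := k) (by simp [ha, hc]) (by simp [ha, e])
      with rfl | rfl | rfl
    exacts [hac rfl, hne ha.symm, hne hc.symm]
  rw [← SimpleGraph.card_neighborFinset_eq_degree, ← card_union_of_disjoint hdisj]
  exact card_le_univ _

theorem TripleFree.card_le_card_image_add_card_doubled [DecidableEq V] (h : TripleFree Φ j)
    (hw : IsWordMap Φ j w) : Fintype.card V ≤ #(univ.image w) + #(doubled Φ j) := by
  have hfiber (y : V) : #{i | w i = y} ≤ 1 + if y ∈ doubled Φ j then 1 else 0 := by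
    split_ifs with hy
    · exact h.card_fiber_le_two hw y
    · refine card_le_one.2 fun p hp q hq ↦ by_contra fun hpq ↦ hy (mem_doubled_iff.2 ?_)
      rw [mem_filter_univ] at hp hq
      exact ⟨w, hw, p, q, hpq, hp, hq⟩
  calc Fintype.card V = ∑ y ∈ univ.image w, #{i | w i = y} :=
        card_eq_sum_card_fiberwise fun i hi ↦ mem_image_of_mem w hi
    _ ≤ ∑ y ∈ univ.image w, (1 + if y ∈ doubled Φ j then 1 else 0) :=
        sum_le_sum fun y _ ↦ hfiber y
    _ = #(univ.image w) + #{y ∈ univ.image w | y ∈ doubled Φ j} := by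
        rw [sum_add_distrib, card_eq_sum_ones, card_filter]
    _ ≤ #(univ.image w) + #(doubled Φ j) :=
        Nat.add_le_add_left (card_le_card fun y hy ↦ (mem_filter.1 hy).2) _

theorem TripleFree.degree_le_card_doubled (h : TripleFree Φ b) (hv : v ∈ doubled Φ j)
    (htj : t + j ≤ b) : (mergeGraph Φ t).degree v ≤ #(doubled Φ j) := by
  classical
  obtain ⟨w, hw, a, c, hac, ha, hc⟩ := mem_doubled_iff.1 hv
  have := h.degree_add_card_image_le hw hac ha hc htj
  have := (h.mono (Nat.le_of_add_left_le htj)).card_le_card_image_add_card_doubled hw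
  omega

theorem TripleFree.four_mul_add_degree_le (h : TripleFree Φ b) (hs : Synchronizing Φ)
    (hconn : StronglyConnected Φ) (hV : 3 ≤ Fintype.card V) (hv : v ∈ doubled Φ j)
    (htj : t + j ≤ b) :
    4 * (b + 1) + 4 * (mergeGraph Φ t).degree v ^ 2 + 4 * (mergeGraph Φ t).degree v ≤
      4 * j + (Fintype.card V + 2) ^ 2 := by
  classical
  have : Nonempty V := ⟨v⟩
  obtain ⟨w, hw, a, c, hac, ha, hc⟩ := mem_doubled_iff.1 hv
  have hjb : j ≤ b := Nat.le_of_add_left_le htj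
  have himage := h.degree_add_card_image_le hw hac ha hc htj
  have hcover := (h.mono hjb).two_mul_card_le hw
  have hpotential := four_mul_potential_add_le (G := mergeGraph Φ j)
    (d := (mergeGraph Φ t).degree v) (by omega)
  have hlength := h.succ_le_add_potential hs hconn hV hjb
  omega

end Degree

section LateDegree

theorem degree_lt_degree_of_adj {V : Type*} {G H : SimpleGraph V} {u v : V}
    [Fintype (G.neighborSet u)] [Fintype (H.neighborSet u)] (hGH : G ≤ H) (hH : H.Adj u v)
    (hG : ¬ G.Adj u v) : G.degree u < H.degree u := by
  have hsub : G.neighborFinset u ⊆ H.neighborFinset u := fun x hx ↦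
    (H.mem_neighborFinset u x).2 (hGH ((G.mem_neighborFinset u x).1 hx))
  exact card_lt_card <| hsub.ssubset_of_mem_notMem ((H.mem_neighborFinset u v).2 hH)
    fun h ↦ hG ((G.mem_neighborFinset u v).1 h)

variable {V : Type*} [Fintype V] {Φ : Set (V → V)} {b r t : ℕ} {v : V}

theorem degree_mergeGraph_mono (Φ : Set (V → V)) (v : V) :
    Monotone fun t ↦ (mergeGraph Φ t).degree v :=
  fun _ _ hst ↦ SimpleGraph.degree_le_of_le (mergeGraph_mono Φ hst)

/-- The degree of `v` in the latest merge graph to which the degree bounds derived from the depth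
of `v` apply when no word of length at most `b` maps three states to one. -/
noncomputable def lateDegree (Φ : Set (V → V)) (b : ℕ) (v : V) : ℕ :=
  (mergeGraph Φ (b - depth Φ v)).degree v

theorem degree_le_lateDegree (h : t + depth Φ v ≤ b) :
    (mergeGraph Φ t).degree v ≤ lateDegree Φ b v :=
  degree_mergeGraph_mono Φ v (Nat.le_sub_of_add_le h)

variable [Nontrivial V]

theorem TripleFree.lateDegree_add_le (h : TripleFree Φ b) (hs : Synchronizing Φ)
    (hc : StronglyConnected Φ) (hb : maxDepth Φ ≤ b) (v : V) :
    lateDegree Φ b v + maxDepth Φ ≤ Fintype.card V + depth Φ v := by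
  have hv := depth_le_maxDepth hs hc v
  have hdegree : lateDegree Φ b v ≤ #(doubled Φ (depth Φ v)) :=
    h.degree_le_card_doubled ((depth_le_iff hs hc).1 le_rfl) (by omega)
  have hgrow := card_doubled_add_le hs hc hv le_rfl
  have := card_le_univ (doubled Φ (maxDepth Φ))
  omega

theorem TripleFree.lateDegree_lt (h : TripleFree Φ b) (hs : Synchronizing Φ)
    (hc : StronglyConnected Φ) (hV : 3 ≤ Fintype.card V) (hb : depth Φ v ≤ b)
    (hlong : (Fintype.card V + 2) ^ 2 < 4 * (b + 1) + 4 * r ^ 2 + 4 * r) {q : ℕ}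
    (hq : depth Φ v ≤ q * (2 * r + q + 1)) : lateDegree Φ b v < r + q := by
  by_contra! hle
  have hbound : 4 * (b + 1) + 4 * lateDegree Φ b v ^ 2 + 4 * lateDegree Φ b v ≤ _ :=
    h.four_mul_add_degree_le hs hc hV ((depth_le_iff hs hc).1 le_rfl) (Nat.sub_add_cancel hb).le
  nlinarith [Nat.pow_le_pow_left hle 2]

theorem TripleFree.two_mul_sub_le_sum_lateDegree (h : TripleFree Φ b) (hs : Synchronizing Φ)
    (hc : StronglyConnected Φ) (hV : 3 ≤ Fintype.card V) (hb : maxDepth Φ ≤ b) :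
    2 * (b - maxDepth Φ) ≤ ∑ v, lateDegree Φ b v :=
  ((h.mono (Nat.sub_le _ _)).two_mul_le_sum_degree hs hV).trans <| sum_le_sum fun v _ ↦
    degree_le_lateDegree (by have := depth_le_maxDepth hs hc v; omega)

/-- If the largest depth is the number of states, then only one state attains it, so every edge
has an endpoint of smaller depth. This applies to an edge appearing at time `b - maxDepth Φ + 1`. -/
theorem TripleFree.two_mul_sub_lt_sum_lateDegree (h : TripleFree Φ b) (hs : Synchronizing Φ)
    (hc : StronglyConnected Φ) (hV : 3 ≤ Fintype.card V) (hb : maxDepth Φ ≤ b)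
    (hcard : maxDepth Φ = Fintype.card V) :
    2 * (b - maxDepth Φ) < ∑ v, lateDegree Φ b v := by
  classical
  set t := b - maxDepth Φ
  have hlt := (h.mono (show t + 1 ≤ b by omega)).mergeGraph_lt_succ hs hV
  obtain ⟨p, q, hnew, hold⟩ :
      ∃ p q, (mergeGraph Φ (t + 1)).Adj p q ∧ ¬ (mergeGraph Φ t).Adj p q := by
    by_contra! hle
    exact hlt.not_ge fun p q ↦ hle p q
  have hlate : #(doubled Φ (maxDepth Φ - 1))ᶜ ≤ 1 := by
    have := le_card_doubled hs hc (Nat.sub_le (maxDepth Φ) 1)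
    rw [card_compl]
    omega
  obtain ⟨u, v, hu, hnew, hold⟩ : ∃ u v, u ∈ doubled Φ (maxDepth Φ - 1) ∧
      (mergeGraph Φ (t + 1)).Adj u v ∧ ¬ (mergeGraph Φ t).Adj u v := by
    by_cases hp : p ∈ doubled Φ (maxDepth Φ - 1)
    · exact ⟨p, q, hp, hnew, hold⟩
    · refine ⟨q, p, by_contra fun hq ↦ hnew.ne ?_, hnew.symm, fun h ↦ hold h.symm⟩
      exact card_le_one.1 hlate _ (mem_compl.2 hp) _ (mem_compl.2 hq)
  have hdepth : depth Φ u ≤ maxDepth Φ - 1 := (depth_le_iff hs hc).2 hu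
  refine ((h.mono (Nat.sub_le _ _)).two_mul_le_sum_degree hs hV).trans_lt <|
    sum_lt_sum (fun v _ ↦ degree_le_lateDegree ?_) ⟨u, mem_univ u, ?_⟩
  · have := depth_le_maxDepth hs hc v
    omega
  · calc (mergeGraph Φ t).degree u < (mergeGraph Φ (t + 1)).degree u :=
          degree_lt_degree_of_adj hlt.le hnew hold
      _ ≤ lateDegree Φ b u := degree_le_lateDegree (by omega)

theorem TripleFree.sum_lateDegree_le (h : TripleFree Φ b) (hs : Synchronizing Φ)
    (hc : StronglyConnected Φ) (hV : 3 ≤ Fintype.card V) (hb : maxDepth Φ ≤ b)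
    (hlong : (Fintype.card V + 2) ^ 2 < 4 * (b + 1) + 4 * r ^ 2 + 4 * r)
    (hr : maxDepth Φ ≤ 2 * r + 2) : ∑ v, lateDegree Φ b v ≤ Fintype.card V * r := by
  rw [← smul_eq_mul, ← card_univ]
  refine sum_le_card_nsmul _ _ _ fun v _ ↦ Nat.le_of_lt_succ ?_
  have hv := depth_le_maxDepth hs hc v
  exact h.lateDegree_lt hs hc hV (hv.trans hb) hlong (q := 1) (by omega)

/-- A state of depth `1` and one of depth `2` have small late degree, which offsets the states of
depth greater than `2 * r + 2`, whose late degree may be `r + 1`. -/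
theorem TripleFree.sum_lateDegree_add_le (h : TripleFree Φ b) (hs : Synchronizing Φ)
    (hc : StronglyConnected Φ) (hV : 3 ≤ Fintype.card V) (hb : maxDepth Φ ≤ b)
    (hlong : (Fintype.card V + 2) ^ 2 < 4 * (b + 1) + 4 * r ^ 2 + 4 * r)
    (hr : Fintype.card V ≤ 4 * r + 6) (htwo : 2 ≤ maxDepth Φ) :
    ∑ v, lateDegree Φ b v + 2 * r + #(doubled Φ (2 * r + 2)) + 2 * maxDepth Φ ≤
      Fintype.card V * r + 3 * Fintype.card V + 3 := by
  classical
  set D := doubled Φ (2 * r + 2)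
  obtain ⟨u, hu⟩ := exists_depth_eq_succ hs hc (Nat.lt_of_succ_lt htwo)
  obtain ⟨v, hv⟩ := exists_depth_eq_succ hs hc htwo
  have hpair : {u, v} ⊆ D := by
    simp only [insert_subset_iff, singleton_subset_iff, D, ← depth_le_iff hs hc, hu, hv]
    omega
  have huv : u ≠ v := fun h ↦ by simp [← h, hu] at hv
  have hdepth (x : V) := depth_le_maxDepth hs hc x
  have hcard := maxDepth_le_card hs hc
  have hearly : ∑ x ∈ D \ {u, v}, lateDegree Φ b x ≤ #(D \ {u, v}) * r :=
    sum_le_card_nsmul _ _ _ fun x hx ↦ Nat.le_of_lt_succ <|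
      h.lateDegree_lt hs hc hV ((hdepth x).trans hb) hlong (q := 1) <| by
        have := (depth_le_iff hs hc).2 (mem_sdiff.1 hx).1
        omega
  have hlate : ∑ x ∈ Dᶜ, lateDegree Φ b x ≤ #Dᶜ * (r + 1) :=
    sum_le_card_nsmul _ _ _ fun x _ ↦ Nat.le_of_lt_succ <|
      h.lateDegree_lt hs hc hV ((hdepth x).trans hb) hlong (q := 2) <| by
        have := hdepth x
        omega
  have hu' := h.lateDegree_add_le hs hc hb u
  have hv' := h.lateDegree_add_le hs hc hb v
  rw [card_sdiff_of_subset hpair, card_pair huv] at hearly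
  rw [card_compl] at hlate
  rw [← sum_add_sum_compl D, ← sum_sdiff hpair, sum_pair huv]
  obtain ⟨k, hk⟩ := Nat.exists_eq_add_of_le (card_pair huv ▸ card_le_card hpair)
  obtain ⟨m, hm⟩ := Nat.exists_eq_add_of_le (card_le_univ D)
  rw [hk] at hm hearly hlate ⊢
  rw [hm] at hlate hu' hv' ⊢
  rw [Nat.add_sub_cancel_left] at hearly hlate
  linarith

end LateDegree

section LengthBound

variable {V : Type*} [Fintype V] {Φ : Set (V → V)} {b r : ℕ}

theorem le_four_mul_of_add_two_sq_lt {n : ℕ} (hupper : 2 * (b + 1) ≤ n * (r + 3))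
    (hlong : (n + 2) ^ 2 < 4 * (b + 1) + 4 * r ^ 2 + 4 * r) : n ≤ 4 * r := by
  by_contra! hlt
  obtain ⟨k, rfl⟩ := Nat.exists_eq_add_of_lt hlt
  nlinarith [sq_nonneg (r - 1 : ℤ)]

theorem TripleFree.two_mul_add_two_lt_maxDepth [Nontrivial V] (h : TripleFree Φ b)
    (hs : Synchronizing Φ) (hc : StronglyConnected Φ) (hV : 3 ≤ Fintype.card V)
    (hb : maxDepth Φ ≤ b) (hlower : Fintype.card V * (r + 2) < 2 * (b + 1))
    (hlong : (Fintype.card V + 2) ^ 2 < 4 * (b + 1) + 4 * r ^ 2 + 4 * r)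
    (hr : Fintype.card V ≤ 4 * r) : 2 * r + 2 < maxDepth Φ := by
  by_contra! hle
  have hedges := h.two_mul_sub_le_sum_lateDegree hs hc hV hb
  have hsum := h.sum_lateDegree_le hs hc hV hb hlong hle
  have hK : maxDepth Φ = Fintype.card V := by
    have := maxDepth_le_card hs hc
    grind
  have hsum' := h.sum_lateDegree_add_le hs hc hV hb hlong (by omega) (by omega)
  have hdoubled : #(doubled Φ (2 * r + 2)) = Fintype.card V := by
    rw [eq_univ_of_forall fun v ↦ doubled_mono Φ hle (mem_doubled_maxDepth hs hc v), card_univ]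
  have htotal := h.two_mul_le hs hV
  rw [hdoubled] at hsum'
  generalize Fintype.card V = n at *
  have hr₂ : r ≤ 2 := by grind
  interval_cases r
  · omega
  · interval_cases n <;> omega
  · omega

theorem TripleFree.four_mul_add_le [Nontrivial V] (h : TripleFree Φ b)
    (hs : Synchronizing Φ) (hc : StronglyConnected Φ) (hV : 3 ≤ Fintype.card V)
    (hlower : Fintype.card V * (r + 2) < 2 * (b + 1))
    (hupper : 2 * (b + 1) ≤ Fintype.card V * (r + 3)) :
    4 * (b + 1) + 4 * r ^ 2 + 4 * r ≤ (Fintype.card V + 2) ^ 2 := by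
  by_contra! hlong
  have hr := le_four_mul_of_add_two_sq_lt hupper hlong
  have hcard := maxDepth_le_card hs hc
  have hb : maxDepth Φ ≤ b := by nlinarith
  have hdepth := h.two_mul_add_two_lt_maxDepth hs hc hV hb hlower hlong hr
  have hedges := h.two_mul_sub_le_sum_lateDegree hs hc hV hb
  have hstrict := h.two_mul_sub_lt_sum_lateDegree hs hc hV hb
  have hsum := h.sum_lateDegree_add_le hs hc hV hb hlong (by omega) (by omega)
  have hdoubled := le_card_doubled hs hc hdepth.le
  generalize Fintype.card V = n at *
  have hsum' : 2 * b + 4 * r ≤ n * r + 3 * n + 1 := by omega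
  have hr' : 4 * r ≤ n + 2 := by grind
  have hr₃ : r ≤ 3 := by
    by_contra! hlt
    nlinarith
  interval_cases r
  · omega
  · omega
  · -- `n = 7` is the only place where the strict inequality `hstrict` matters.
    interval_cases n <;> omega
  · interval_cases n <;> omega

/-- It suffices to treat the largest `r` with `n * (r + 2) < 2 * (b + 1)`. -/
theorem TripleFree.length_bound (h : TripleFree Φ b) (hs : Synchronizing Φ)
    (hc : StronglyConnected Φ) (hV : 3 ≤ Fintype.card V) (s : ℕ) :
    2 * (b + 1) ≤ Fintype.card V * (s + 2) ∨
      4 * (b + 1) + 4 * s ^ 2 + 4 * s ≤ (Fintype.card V + 2) ^ 2 := by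
  have : Nontrivial V := Fintype.one_lt_card_iff_nontrivial.1 (Nat.lt_of_succ_lt hV)
  refine or_iff_not_imp_left.2 fun hlt ↦ ?_
  have hq : s + 2 ≤ (2 * b + 1) / Fintype.card V :=
    (Nat.le_div_iff_mul_le (by omega)).2 (by grind)
  obtain ⟨r, hr⟩ := Nat.exists_eq_add_of_le' (Nat.le_of_add_left_le hq)
  have hlower := Nat.mul_div_le (2 * b + 1) (Fintype.card V)
  have hupper := Nat.lt_mul_div_succ (2 * b + 1) (show 0 < Fintype.card V by omega)
  rw [hr] at hq hlower hupper
  have hsr : s ≤ r := Nat.le_of_add_le_add_right hq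
  calc 4 * (b + 1) + 4 * s ^ 2 + 4 * s ≤ 4 * (b + 1) + 4 * r ^ 2 + 4 * r := by gcongr
    _ ≤ (Fintype.card V + 2) ^ 2 :=
      h.four_mul_add_le hs hc hV (Nat.lt_of_le_of_lt hlower (by omega)) hupper

end LengthBound

section Matrices

variable {n t : ℕ} {S : Set (Matrix (Fin n) (Fin n) ℝ)} {L W : Matrix (Fin n) (Fin n) ℝ}

/-- The row-stochastic matrix of a transformation, whose row `i` is the basis vector of `f i`. -/
def toMat (f : Fin n → Fin n) : Matrix (Fin n) (Fin n) ℝ :=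
  Matrix.of fun i ↦ Pi.single (f i) 1

theorem toMat_apply (f : Fin n → Fin n) (i j : Fin n) :
    toMat f i j = if f i = j then 1 else 0 := by
  simp [toMat, Pi.single_apply, eq_comm]

theorem toMat_apply_eq_one_iff {f : Fin n → Fin n} {i j : Fin n} : toMat f i j = 1 ↔ f i = j := by
  simp [toMat_apply]

theorem toMat_id : toMat (id : Fin n → Fin n) = 1 := by
  ext i j
  simp [toMat_apply, Matrix.one_apply]

theorem toMat_mul (f w : Fin n → Fin n) : toMat f * toMat w = toMat (w ∘ f) := by
  ext i j
  simp only [Matrix.mul_apply, toMat_apply, ite_mul, one_mul, zero_mul, sum_ite_eq, mem_univ,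
    if_true, Function.comp_apply]

theorem exists_eq_toMat (h01 : ∀ i j, L i j = 0 ∨ L i j = 1) (hsum : ∀ i, ∑ j, L i j = 1) :
    ∃ f, L = toMat f := by
  have hone (i : Fin n) : ∃ j, L i j = 1 := by
    by_contra! hne
    exact zero_ne_one ((sum_eq_zero fun j _ ↦ (h01 i j).resolve_right (hne j)).symm.trans (hsum i))
  choose f hf using hone
  refine ⟨f, Matrix.ext fun i j ↦ ?_⟩
  rw [toMat_apply]
  split_ifs with hj
  · rw [← hj, hf]
  · have hle : L i (f i) + L i j ≤ ∑ k, L i k :=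
      add_le_sum (fun k _ ↦ by rcases h01 i k with h | h <;> simp [h]) (mem_univ _) (mem_univ j) hj
    rw [hf, hsum] at hle
    exact (h01 i j).resolve_right fun h ↦ by linarith

/-- The transformations whose matrices are the letters of an automaton. -/
def letters (S : Set (Matrix (Fin n) (Fin n) ℝ)) : Set (Fin n → Fin n) :=
  {f | toMat f ∈ S}

theorem mem_wordsUpTo_iff (hS : IsAutomaton S) :
    W ∈ wordsUpTo S t ↔ ∃ w, IsWordMap (letters S) t w ∧ W = toMat w := by
  constructor
  · rintro ⟨r, hr, l, rfl, hl, rfl⟩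
    induction l generalizing t with
    | nil => exact ⟨id, .nil t, toMat_id.symm⟩
    | cons L l ih =>
      obtain ⟨t, rfl⟩ := Nat.exists_eq_add_of_le' ((Nat.succ_pos _).trans_le hr)
      obtain ⟨hL, hl⟩ := List.forall_mem_cons.1 hl
      obtain ⟨w, hw, hprod⟩ := ih (Nat.succ_le_succ_iff.1 hr) hl
      obtain ⟨f, rfl⟩ := exists_eq_toMat (hS L hL).1 (hS L hL).2
      exact ⟨w ∘ f, .cons hL hw, by rw [List.prod_cons, hprod, toMat_mul]⟩
  · rintro ⟨w, hw, rfl⟩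
    induction hw with
    | nil t => exact ⟨0, t.zero_le, [], rfl, by simp, toMat_id.symm⟩
    | @cons t w f hf _ ih =>
      obtain ⟨_, hr, l, rfl, hl, hprod⟩ := ih
      exact ⟨_, Nat.succ_le_succ hr, toMat f :: l, rfl, List.forall_mem_cons.2 ⟨hf, hl⟩,
        by rw [List.prod_cons, hprod, toMat_mul]⟩

theorem hammingNorm_toMat (w : Fin n → Fin n) (j : Fin n) :
    hammingNorm (fun i ↦ toMat w i j) = #{i | w i = j} := by
  simp [hammingNorm, toMat_apply]

theorem mem_tripleTimes_iff (hS : IsAutomaton S) :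
    t ∈ tripleTimes S ↔ ¬ TripleFree (letters S) t := by
  simp only [TripleFree, not_forall, not_or]
  constructor
  · rintro ⟨_, ⟨W, hW, j, rfl⟩, hthree⟩
    obtain ⟨w, hw, rfl⟩ := (mem_wordsUpTo_iff hS).1 hW
    rw [hammingNorm_toMat] at hthree
    obtain ⟨i, hi, i', hi', k, hk, hii', hik, hi'k⟩ := two_lt_card.1 hthree
    simp only [mem_filter_univ] at hi hi' hk
    exact ⟨w, hw, i, i', k, hi.trans hi'.symm, hi.trans hk.symm, hii', hik, hi'k⟩
  · rintro ⟨w, hw, i, i', k, hi', hk, hii', hik, hi'k⟩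
    refine ⟨_, ⟨toMat w, (mem_wordsUpTo_iff hS).2 ⟨w, hw, rfl⟩, w i, rfl⟩, ?_⟩
    rw [hammingNorm_toMat]
    exact two_lt_card.2 ⟨i, by simp, i', by simp [hi'], k, by simp [hk], hii', hik, hi'k⟩

theorem synchronizing_letters (hS : IsAutomaton S) (h : IsSynchronizing S) :
    Synchronizing (letters S) := by
  obtain ⟨t, W, z, hW, hWz⟩ := h
  obtain ⟨w, hw, rfl⟩ := (mem_wordsUpTo_iff hS).1 ⟨t, le_rfl, hW⟩
  exact ⟨t, w, z, hw, fun i ↦ toMat_apply_eq_one_iff.1 (by simp [hWz])⟩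

theorem stronglyConnected_letters (hS : IsAutomaton S) (h : IsStronglyConnected S) :
    StronglyConnected (letters S) := by
  refine fun i j ↦ Relation.ReflTransGen.mono ?_ i j (h i j)
  rintro a c ⟨L, hL, hac⟩
  obtain ⟨f, rfl⟩ := exists_eq_toMat (hS L hL).1 (hS L hL).2
  exact ⟨f, hL, toMat_apply_eq_one_iff.1 hac⟩

theorem tripleTimes_nonempty (hS : IsAutomaton S) (hsync : IsSynchronizing S) (hn : 3 ≤ n) :
    (tripleTimes S).Nonempty := by
  obtain ⟨t, w, z, hw, hz⟩ := synchronizing_letters hS hsync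
  refine ⟨t, (mem_tripleTimes_iff hS).2 fun h ↦ ?_⟩
  have hcard := h.card_fiber_le_two hw z
  simp only [hz, filter_true, card_univ, Fintype.card_fin] at hcard
  omega

end Matrices

end TripleRendezvous

open TripleRendezvous in
theorem mainTheorem4_general (n : ℕ) (hn : 3 ≤ n) (S : Set (Matrix (Fin n) (Fin n) ℝ))
    (hS : IsAutomaton S) (hsync : IsSynchronizing S) (hconn : IsStronglyConnected S) (s : ℕ) :
    (tripleTimes S).Nonempty ∧
      (tripleRendezvousTime S : ℝ) ≤
        max ((n : ℝ) * ((s : ℝ) + 2) / 2)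
          (((n : ℝ) * ((n : ℝ) + 4) - (2 * (s : ℝ) - 1) * (2 * (s : ℝ) + 3) + 1) / 4) := by
  refine ⟨tripleTimes_nonempty hS hsync hn, ?_⟩
  rcases hT : tripleRendezvousTime S with _ | b
  · exact le_max_of_le_left (by push_cast; positivity)
  have hfree : TripleFree (letters S) b := by
    rw [← not_not (a := TripleFree _ _), ← mem_tripleTimes_iff hS]
    exact Nat.notMem_of_lt_sInf (b.lt_succ_self.trans_eq hT.symm)
  have hbound := hfree.length_bound (synchronizing_letters hS hsync)
    (stronglyConnected_letters hS hconn) (by rwa [Fintype.card_fin]) s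
  rw [Fintype.card_fin] at hbound
  obtain hle | hle := hbound <;> rify at hle <;> push_cast
  · exact le_max_of_le_left (by linarith)
  · exact le_max_of_le_right (by linarith)

theorem mainTheorem4 (n : ℕ) (hn : 3 ≤ n) (S : Set (Matrix (Fin n) (Fin n) ℝ))
    (hS : IsAutomaton S) (hsync : IsSynchronizing S) (hconn : IsStronglyConnected S)
    (s : ℕ) (hs1 : 1 ≤ s) (hs2 : (s : ℝ) ≤ (n : ℝ) / 2) :
    (tripleTimes S).Nonempty ∧
      (tripleRendezvousTime S : ℝ) ≤
        max ((n : ℝ) * ((s : ℝ) + 2) / 2)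
          (((n : ℝ) * ((n : ℝ) + 4) - (2 * (s : ℝ) - 1) * (2 * (s : ℝ) + 3) + 1) / 4) :=
  mainTheorem4_general n hn S hS hsync hconn s
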